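/- Let $\mathcal{A}=\{1<2<3<\cdots\}$ and let $\mathcal{A}^*$ be the set of finite words over $\mathcal{A}$. *Quasi-crystal graph.* For $i\ge 1$ the partial operator $\ddot f_i$ on $\mathcal{A}^*$ is defined at $u$ exactly when $u$ contains a symbol $i$ and has no symbol $i+1$ to the left of a symbol $i$; then $\ddot f_i(u)$ is obtained from $u$ by replacing the right-most $i$ by $i+1$. The quasi-crystal graph $\Gamma$ is the labelled directed graph with vertex set $\mathcal{A}^*$ and an edge $u\to v$ labelled $i$ if and only if $v=\ddot f_i(u)$. Let $\Gamma(u)$ be the (undirected) connected component of $\Gamma$ containing $u$. *The relation $\sim_{\mathsf{baxt}}$.* For $u=u_1\cdots u_k\in\mathcal{A}^*$, let $\mathrm{std}(u)$ be the word whose $p$-th symbol is the rank of position $p$ when positions are ordered by $q\prec p \iff u_q<u_p$ or ($u_q=u_p$ and $q<p$), and let $\mathrm{std}(u)^{-1}$ be its inverse as a permutation in one-line notation. For a word $w$ without repeated symbols, the increasing tree of $w$ is empty if $w$ is empty; otherwise $w=tnt'$ with $n$ the minimum symbol of $w$, and the tree is the binary tree with root $n$ whose left and right subtrees are the increasing trees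 of $t$ and $t'$. The decreasing tree of $w$ is defined in the same way with the maximum symbol in place of the minimum. Let $\sigma_{\mathsf{baxt}}(u)$ be the pair of underlying unlabelled binary trees (shapes) of the increasing tree and the decreasing tree of $\mathrm{std}(u)^{-1}$. Write $u\sim_{\mathsf{baxt}}v$ if there is an isomorphism of labelled directed graphs $\theta:\Gamma(u)\to\Gamma(v)$ with $\theta(u)=v$ and $\sigma_{\mathsf{baxt}}(\theta(w))=\sigma_{\mathsf{baxt}}(w)$ for every vertex $w$ of $\Gamma(u)$. *The Baxter congruence.* Let $T_L(u)$ be the left strict binary search tree obtained by inserting the symbols of $u$ from left to right into the empty tree by leaf insertion, where a symbol $a$ goes to the right subtree of a node labelled $x$ if $a\ge x$ and to the left subtree otherwise. Let $T_R(u)$ be the right strict binary search tree obtained by inserting the symbols of $u$ from right to left, where $a$ goes to the left subtree of a node labelled $x$ if $a\le x$ and to the right subtree otherwise. Write $u\equiv_{\mathsf{baxt}}v$ if $T_L(u)=T_L(v)$ and $T_R(u)=T_R(v)$. **Proposition.** The relations $\sim_{\mathsf{baxt}}$ and $\equiv_{\mathsf{baxt}}$ on $\mathcal{A}^*$ coincide: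 for all $u,v\in\mathcal{A}^*$, $u\sim_{\mathsf{baxt}}v$ if and only if $u\equiv_{\mathsf{baxt}}v$. -/

import Mathlib

namespace Baxt

/-- Words over the infinite ordered alphabet `{1 < 2 < 3 < ⋯}`. -/
abbrev Word : Type := List ℕ+

/-! ### The quasi-crystal graph -/

/-- The quasi-Kashiwara lowering operator `f_i` (`none` means undefined). It is undefined if the
word contains `i + 1` somewhere to the left of an `i`, or contains no `i`; otherwise it replaces
the right-most `i` by `i + 1`. -/
def lower (i : ℕ+) (u : Word) : Option Word :=
  if [i + 1, i].Sublist u then none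
  else if i ∈ u then some (u.reverse.set (u.reverse.idxOf i) (i + 1)).reverse
  else none

/-- In the quasi-crystal graph there is an edge from `x` to `y` labelled by `i`. -/
def Edge (i : ℕ+) (x y : Word) : Prop := lower i x = some y

/-- The vertex set of the connected component of the quasi-crystal graph containing `u`
(connectedness disregards labels and directions of edges). -/
def component (u : Word) : Set Word :=
  {x | Relation.EqvGen (fun y z => ∃ i : ℕ+, Edge i y z) u x}

theorem mem_component_self (u : Word) : u ∈ component u := Relation.EqvGen.refl u

/-- A quasi-crystal isomorphism: an isomorphism of labelled directed graphs between the connected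
components of `u` and of `v`. It need not send `u` to `v`. -/
structure QuasiCrystalIso (u v : Word) extends component u ≃ component v where
  edge_iff : ∀ (i : ℕ+) (x y : component u),
    Edge i (toEquiv x : Word) (toEquiv y : Word) ↔ Edge i (x : Word) (y : Word)

/-- `θ` preserves the map `σ` (the "shape"). -/
def QuasiCrystalIso.ShapePreserving {S : Type*} (σ : Word → S) {u v : Word}
    (θ : QuasiCrystalIso u v) : Prop :=
  ∀ w : component u, σ (w : Word) = σ (θ.toEquiv w : Word)

/-- The relation `∼_σ`: some `σ`-preserving quasi-crystal isomorphism from the component of `u` to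
the component of `v` sends `u` to `v`. -/
def SimShape {S : Type*} (σ : Word → S) (u v : Word) : Prop :=
  ∃ θ : QuasiCrystalIso u v,
    θ.ShapePreserving σ ∧ (θ.toEquiv ⟨u, mem_component_self u⟩ : Word) = v

/-! ### Standardization -/

/-- Position `q` comes before position `p` when the occurrences of letters of `u` are ordered by
letter, and from left to right among equal letters. -/
def Before (u : Word) (q p : Fin u.length) : Prop :=
  u.get q < u.get p ∨ (u.get q = u.get p ∧ q < p)

instance (u : Word) (q p : Fin u.length) : Decidable (Before u q p) :=
  inferInstanceAs (Decidable (_ ∨ _))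

/-- The standardization of `u`: the symbol in position `p` is the rank (starting from `1`) of
position `p` in the order `Before u`. -/
def std (u : Word) : Word :=
  List.ofFn fun p : Fin u.length =>
    Nat.succPNat (Finset.univ.filter fun q : Fin u.length => Before u q p).card

/-- The inverse of a standard word, viewed as a permutation in one-line notation: its `j`-th symbol
is the position of the symbol `j` (both counted from `1`; here `Nat.succPNat` adds `1`). -/
def inverse (s : Word) : Word :=
  List.ofFn fun j : Fin s.length => Nat.succPNat (s.idxOf (Nat.succPNat j))

/-! ### Increasing and decreasing trees, and the shape map -/

/-- The shape of a labelled binary tree: the underlying unlabelled tree. -/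
def shape {α : Type*} (T : BinaryTree α) : BinaryTree Unit := T.map fun _ => ()

/-- The increasing tree of a word without repeated symbols: if `n` is the minimum of `u = t n t'`,
the root is `n`, with subtrees the increasing trees of `t` and `t'`. -/
def incTree (u : Word) : BinaryTree ℕ+ :=
  if h : u = [] then .nil
  else
    have hlt : u.idxOf (u.min h) < u.length := List.idxOf_lt_length_of_mem (List.min_mem h)
    .node (u.min h) (incTree (u.take (u.idxOf (u.min h))))
      (incTree (u.drop (u.idxOf (u.min h) + 1)))
termination_by u.length
decreasing_by
  · rw [List.length_take]; omega
  · rw [List.length_drop]; omega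

/-- The decreasing tree of a word without repeated symbols: if `m` is the maximum of `u = s m s'`,
the root is `m`, with subtrees the decreasing trees of `s` and `s'`. -/
def decTree (u : Word) : BinaryTree ℕ+ :=
  if h : u = [] then .nil
  else
    have hlt : u.idxOf (u.max h) < u.length := List.idxOf_lt_length_of_mem (List.max_mem h)
    .node (u.max h) (decTree (u.take (u.idxOf (u.max h))))
      (decTree (u.drop (u.idxOf (u.max h) + 1)))
termination_by u.length
decreasing_by
  · rw [List.length_take]; omega
  · rw [List.length_drop]; omega

/-- The map `σ_baxt`: the shapes of the increasing and the decreasing tree of `std(u)⁻¹`. -/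
def baxtShape (u : Word) : BinaryTree Unit × BinaryTree Unit :=
  (shape (incTree (inverse (std u))), shape (decTree (inverse (std u))))

/-- The relation `∼_baxt`. -/
def SimBaxt (u v : Word) : Prop := SimShape baxtShape u v

/-! ### Insertion into binary search trees and the Baxter congruence -/

/-- Left strict leaf insertion. -/
def leftInsert : BinaryTree ℕ+ → ℕ+ → BinaryTree ℕ+
  | .nil, a => .node a .nil .nil
  | .node x l r, a => if x ≤ a then .node x l (leftInsert r a) else .node x (leftInsert l a) r

/-- Right strict leaf insertion. -/
def rightInsert (a : ℕ+) : BinaryTree ℕ+ → BinaryTree ℕ+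
  | .nil => .node a .nil .nil
  | .node x l r => if a ≤ x then .node x (rightInsert a l) r else .node x l (rightInsert a r)

/-- The left strict binary search tree of a word, whose symbols are inserted from left to right. -/
def leftTree (u : Word) : BinaryTree ℕ+ := u.foldl leftInsert .nil

/-- The right strict binary search tree of a word, whose symbols are inserted from right to left. -/
def rightTree (u : Word) : BinaryTree ℕ+ := u.foldr rightInsert .nil

/-- The Baxter P-symbol of a word: a pair of twin binary search trees. -/
def baxtP (u : Word) : BinaryTree ℕ+ × BinaryTree ℕ+ := (leftTree u, rightTree u)

/-- The Baxter congruence `≡_baxt`: equality of P-symbols. -/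
def BaxtEquiv (u v : Word) : Prop := baxtP u = baxtP v

end Baxt

/-!
The operator `f_i` increments the last `i` among the letters of a word sorted stably, and it is
defined exactly if this does not change the standardization (`edge_ofFn_iff_sort`). So all words
in a component have the same standardization, and a word in it amounts to its content, a weakly
increasing sequence that increases strictly at each descent of the inverse standardization.

The shapes of the increasing and decreasing trees of `std(u)⁻¹` are the shapes of the search trees
of `u` (`baxtShape_eq`): the letter inserted first is the root, and the others are split by
comparing them with it. As the infix reading of a search tree is the sorted word, `≡_baxt` says
that two words have the same content and the same shape (`baxtEquiv_iff`). It remains to compare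
this with `∼_baxt`.

* An isomorphism between components that sends `u` to `v` forces the contents to agree
  (`QuasiCrystalIso.perm`): operators `f_k` with `k > i` clear the letter `i + 1` from `u`, and then
  `f_i` can be applied as many times as `u` has letters `i`. The same operators then apply to `v`,
  which bounds its number of letters `i` from below; exchange `u` and `v` for the other bound.
* Conversely, the descents of `std(u)⁻¹` can be read off the shape of its decreasing tree
  (`descents_eq_canopy`). If `u` and `v` have the same shape, then the same contents occur in both
  components, and relating words of equal content is a bisimulation (`isSimulation_matched`), that
  is, an isomorphism. It sends `u` to `v` if these have the same content, and it preserves shapes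
  because they depend on the standardization only.
-/

namespace Baxt

/-! ### Binary search trees -/

/-- The labels of a binary tree in infix (left, root, right) order. -/
def inorder {α : Type*} : BinaryTree α → List α
  | .nil => []
  | .node a l r => inorder l ++ a :: inorder r

theorem length_inorder_of_shape_eq {α β : Type*} :
    ∀ {S : BinaryTree α} {T : BinaryTree β}, shape S = shape T →
      (inorder S).length = (inorder T).length
  | .nil, .nil, _ => rfl
  | .nil, .node _ _ _, h => by simp [shape, BinaryTree.map] at h
  | .node _ _ _, .nil, h => by simp [shape, BinaryTree.map] at h
  | .node _ l r, .node _ l' r', h => by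
    simp only [shape, BinaryTree.map, BinaryTree.node.injEq, true_and] at h
    have h1 := length_inorder_of_shape_eq (S := l) (T := l') h.1
    have h2 := length_inorder_of_shape_eq (S := r) (T := r') h.2
    simp [inorder, h1, h2]

theorem eq_of_shape_eq_of_inorder_eq {α : Type*} :
    ∀ {S T : BinaryTree α}, shape S = shape T → inorder S = inorder T → S = T
  | .nil, .nil, _, _ => rfl
  | .nil, .node _ _ _, h, _ => by simp [shape, BinaryTree.map] at h
  | .node _ _ _, .nil, h, _ => by simp [shape, BinaryTree.map] at h
  | .node a l r, .node b l' r', h, hi => by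
    simp only [shape, BinaryTree.map, BinaryTree.node.injEq, true_and] at h
    obtain ⟨h1, h2⟩ := List.append_inj hi (length_inorder_of_shape_eq (S := l) (T := l') h.1)
    rw [List.cons.injEq] at h2
    rw [eq_of_shape_eq_of_inorder_eq (S := l) (T := l') h.1 h1,
      eq_of_shape_eq_of_inorder_eq (S := r) (T := r') h.2 h2.2, h2.1]

theorem foldl_leftInsert_node (a : ℕ+) (u : Word) (l r : BinaryTree ℕ+) :
    u.foldl leftInsert (.node a l r) =
      .node a ((u.filter (¬ a ≤ ·)).foldl leftInsert l) ((u.filter (a ≤ ·)).foldl leftInsert r) := by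
  induction u generalizing l r with
  | nil => rfl
  | cons b u ih =>
    by_cases h : a ≤ b
    · simp [List.foldl_cons, ih, leftInsert, h]
    · simp [List.foldl_cons, ih, leftInsert, h, not_le.1 h]

theorem leftTree_cons (a : ℕ+) (u : Word) :
    leftTree (a :: u) = .node a (leftTree (u.filter (¬ a ≤ ·))) (leftTree (u.filter (a ≤ ·))) :=
  foldl_leftInsert_node a u .nil .nil

theorem foldr_rightInsert_node (a : ℕ+) (u : Word) (l r : BinaryTree ℕ+) :
    u.foldr rightInsert (.node a l r) =
      .node a ((u.filter (· ≤ a)).foldr rightInsert l)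
        ((u.filter (¬ · ≤ a)).foldr rightInsert r) := by
  induction u generalizing l r with
  | nil => rfl
  | cons b u ih =>
    by_cases h : b ≤ a
    · simp [List.foldr_cons, ih, rightInsert, h]
    · simp [List.foldr_cons, ih, rightInsert, h, not_le.1 h]

theorem rightTree_append_singleton (u : Word) (a : ℕ+) :
    rightTree (u ++ [a]) =
      .node a (rightTree (u.filter (· ≤ a))) (rightTree (u.filter (¬ · ≤ a))) := by
  rw [rightTree, List.foldr_append]
  exact foldr_rightInsert_node a u .nil .nil

theorem inorder_leftTree (u : Word) :
    (inorder (leftTree u)).Pairwise (· ≤ ·) ∧ (inorder (leftTree u)).Perm u := by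
  induction hn : u.length using Nat.strong_induction_on generalizing u with
  | _ n ih =>
    cases u with
    | nil => simp [leftTree, inorder]
    | cons a u =>
      subst hn
      obtain ⟨s1, p1⟩ := ih _ (Nat.lt_succ_of_le (List.length_filter_le (¬ a ≤ ·) u)) _ rfl
      obtain ⟨s2, p2⟩ := ih _ (Nat.lt_succ_of_le (List.length_filter_le (a ≤ ·) u)) _ rfl
      rw [leftTree_cons, inorder]
      refine ⟨?_, ?_⟩
      · rw [List.pairwise_append, List.pairwise_cons]
        have h1 : ∀ x ∈ inorder (leftTree (u.filter (¬ a ≤ ·))), x < a := fun x hx => by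
          simpa using (List.mem_filter.1 (p1.mem_iff.1 hx)).2
        have h2 : ∀ x ∈ inorder (leftTree (u.filter (a ≤ ·))), a ≤ x := fun x hx => by
          simpa using (List.mem_filter.1 (p2.mem_iff.1 hx)).2
        refine ⟨s1, ⟨h2, s2⟩, fun x hx y hy => ?_⟩
        rcases List.mem_cons.1 hy with rfl | hy
        · exact (h1 x hx).le
        · exact (h1 x hx).le.trans (h2 y hy)
      · refine List.perm_middle.trans (.cons a ((p1.append p2).trans ?_))
        have := List.filter_append_perm (fun x => decide (¬ a ≤ x)) u
        simpa only [decide_not, Bool.not_not] using this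

theorem inorder_rightTree (u : Word) :
    (inorder (rightTree u)).Pairwise (· ≤ ·) ∧ (inorder (rightTree u)).Perm u := by
  induction hn : u.length using Nat.strong_induction_on generalizing u with
  | _ n ih =>
    rcases List.eq_nil_or_concat' u with rfl | ⟨u, a, rfl⟩
    · simp [rightTree, inorder]
    · have hl : ∀ p : ℕ+ → Bool, (u.filter p).length < n := fun p => by
        rw [← hn, List.length_append]
        exact Nat.lt_succ_of_le (List.length_filter_le p u)
      obtain ⟨s1, p1⟩ := ih _ (hl (· ≤ a)) _ rfl
      obtain ⟨s2, p2⟩ := ih _ (hl (¬ · ≤ a)) _ rfl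
      rw [rightTree_append_singleton, inorder]
      refine ⟨?_, ?_⟩
      · rw [List.pairwise_append, List.pairwise_cons]
        have h1 : ∀ x ∈ inorder (rightTree (u.filter (· ≤ a))), x ≤ a := fun x hx => by
          simpa using (List.mem_filter.1 (p1.mem_iff.1 hx)).2
        have h2 : ∀ x ∈ inorder (rightTree (u.filter (¬ · ≤ a))), a ≤ x := fun x hx => by
          have : a < x := by simpa using (List.mem_filter.1 (p2.mem_iff.1 hx)).2
          exact this.le
        refine ⟨s1, ⟨h2, s2⟩, fun x hx y hy => ?_⟩
        rcases List.mem_cons.1 hy with rfl | hy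
        · exact h1 x hx
        · exact (h1 x hx).trans (h2 y hy)
      · refine List.perm_middle.trans (List.Perm.trans ?_ (List.perm_append_singleton a u).symm)
        refine .cons a ((p1.append p2).trans ?_)
        have := List.filter_append_perm (fun x => decide (x ≤ a)) u
        simpa only [decide_not] using this

/-- The labels of both search trees are forced by their shapes and the content of the word, since
their infix readings are the sorted rearrangement of the word. -/
theorem baxtEquiv_iff (u v : Word) :
    BaxtEquiv u v ↔ u.Perm v ∧ shape (leftTree u) = shape (leftTree v) ∧
      shape (rightTree u) = shape (rightTree v) := by
  rw [BaxtEquiv, baxtP, baxtP, Prod.mk.injEq]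
  constructor
  · rintro ⟨h1, h2⟩
    refine ⟨(inorder_leftTree u).2.symm.trans ?_, by rw [h1], by rw [h2]⟩
    rw [h1]
    exact (inorder_leftTree v).2
  · rintro ⟨hp, h1, h2⟩
    refine ⟨eq_of_shape_eq_of_inorder_eq h1 ?_, eq_of_shape_eq_of_inorder_eq h2 ?_⟩
    · obtain ⟨⟨s1, p1⟩, s2, p2⟩ := And.intro (inorder_leftTree u) (inorder_leftTree v)
      exact ((p1.trans hp).trans p2.symm).eq_of_pairwise' s1 s2
    · obtain ⟨⟨s1, p1⟩, s2, p2⟩ := And.intro (inorder_rightTree u) (inorder_rightTree v)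
      exact ((p1.trans hp).trans p2.symm).eq_of_pairwise' s1 s2

/-! ### Increasing and decreasing trees -/

theorem incTree_append_cons {l r : Word} {t : ℕ+} (hl : ∀ x ∈ l, t < x) (hr : ∀ x ∈ r, t < x) :
    incTree (l ++ t :: r) = .node t (incTree l) (incTree r) := by
  have hne : l ++ t :: r ≠ [] := by simp
  have hmin : (l ++ t :: r).min hne = t := by
    rw [List.min_eq_iff]
    refine ⟨by simp, fun x hx => ?_⟩
    rw [List.mem_append, List.mem_cons] at hx
    rcases hx with hx | rfl | hx
    exacts [(hl x hx).le, le_rfl, (hr x hx).le]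
  have hidx : (l ++ t :: r).idxOf t = l.length := by
    rw [List.idxOf_append_of_notMem fun h => (hl t h).false]
    simp
  rw [incTree, dif_neg hne]
  simp [hmin, hidx]

theorem decTree_append_cons {l r : Word} {t : ℕ+} (hl : ∀ x ∈ l, x < t) (hr : ∀ x ∈ r, x < t) :
    decTree (l ++ t :: r) = .node t (decTree l) (decTree r) := by
  have hne : l ++ t :: r ≠ [] := by simp
  have hmax : (l ++ t :: r).max hne = t := by
    rw [List.max_eq_iff]
    refine ⟨by simp, fun x hx => ?_⟩
    rw [List.mem_append, List.mem_cons] at hx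
    rcases hx with hx | rfl | hx
    exacts [(hl x hx).le, le_rfl, (hr x hx).le]
  have hidx : (l ++ t :: r).idxOf t = l.length := by
    rw [List.idxOf_append_of_notMem fun h => (hl t h).false]
    simp
  rw [decTree, dif_neg hne]
  simp [hmax, hidx]

theorem perm_filter_of_append_perm {α : Type*} {l r T : List α} (p : α → Bool)
    (h : (l ++ r).Perm T) (hl : ∀ x ∈ l, p x = true) (hr : ∀ x ∈ r, p x = false) :
    l.Perm (T.filter p) ∧ r.Perm (T.filter fun x => !p x) := by
  constructor
  · have := h.filter p
    rwa [List.filter_append, List.filter_eq_self.2 hl,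
      List.filter_eq_nil_iff.2 (fun x hx => by simp [hr x hx]), List.append_nil] at this
  · have := h.filter fun x => !p x
    rwa [List.filter_append, List.filter_eq_nil_iff.2 (fun x hx => by simp [hl x hx]),
      List.filter_eq_self.2 (fun x hx => by simp [hr x hx]), List.nil_append] at this

/-- Let `T` be an increasing list of times, the time `t` carrying the letter `f t`, and let `L`
list these times ordered by letter and then by time. Then the increasing tree of `L` has the shape
of the tree obtained by inserting the letters in order of time: in both, the first time is the root
and the later ones are split by comparing their letters with its letter. -/
theorem shape_incTree_eq (f : ℕ+ → ℕ+) (T L : Word) (hT : T.Pairwise (· < ·)) (hp : L.Perm T)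
    (hL : L.Pairwise fun p q => f p < f q ∨ (f p = f q ∧ p < q)) :
    shape (incTree L) = shape (leftTree (T.map f)) := by
  induction hn : T.length using Nat.strong_induction_on generalizing T L with
  | _ n ih =>
    cases T with
    | nil => rw [hp.eq_nil]; simp [incTree, leftTree]
    | cons t T =>
      subst hn
      rw [List.pairwise_cons] at hT
      obtain ⟨l, r, rfl⟩ := List.append_of_mem (hp.mem_iff.2 (List.mem_cons_self (a := t) (l := T)))
      have hp' : (l ++ r).Perm T := (List.perm_middle.symm.trans hp).cons_inv
      have hlt : ∀ x ∈ l, t < x := fun x hx => hT.1 x (hp'.mem_iff.1 (List.mem_append_left r hx))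
      have hrt : ∀ x ∈ r, t < x := fun x hx => hT.1 x (hp'.mem_iff.1 (List.mem_append_right l hx))
      rw [List.pairwise_append, List.pairwise_cons] at hL
      obtain ⟨hl, ⟨hr1, hr⟩, hlr⟩ := hL
      have hlf : ∀ x ∈ l, f x < f t := fun x hx => by
        rcases hlr x hx t List.mem_cons_self with h | h
        exacts [h, absurd (hlt x hx) h.2.not_gt]
      have hrf : ∀ x ∈ r, f t ≤ f x := fun x hx => by
        rcases hr1 x hx with h | h
        exacts [h.le, h.1.le]
      obtain ⟨p1, p2⟩ := perm_filter_of_append_perm (fun x => decide (¬ f t ≤ f x)) hp'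
        (fun x hx => by simpa using hlf x hx) (fun x hx => by simpa using hrf x hx)
      have e1 := ih _ (Nat.lt_succ_of_le (List.length_filter_le _ T)) _ l (hT.2.filter _) p1 hl rfl
      have e2 := ih _ (Nat.lt_succ_of_le (List.length_filter_le _ T)) _ r (hT.2.filter _) p2 hr rfl
      rw [incTree_append_cons hlt hrt, List.map_cons, leftTree_cons, List.filter_map,
        List.filter_map]
      simp only [decide_not, Bool.not_not] at e1 e2
      simp only [decide_not, shape, BinaryTree.map, BinaryTree.node.injEq, true_and] at e1 e2 ⊢
      exact ⟨e1, e2⟩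

/-- The counterpart of `shape_incTree_eq` for decreasing trees and insertion from right to left:
here the last time is the root of both trees. -/
theorem shape_decTree_eq (f : ℕ+ → ℕ+) (T L : Word) (hT : T.Pairwise (· < ·)) (hp : L.Perm T)
    (hL : L.Pairwise fun p q => f p < f q ∨ (f p = f q ∧ p < q)) :
    shape (decTree L) = shape (rightTree (T.map f)) := by
  induction hn : T.length using Nat.strong_induction_on generalizing T L with
  | _ n ih =>
    rcases List.eq_nil_or_concat' T with rfl | ⟨T, t, rfl⟩
    · rw [hp.eq_nil]; simp [decTree, rightTree]
    · have hlen : ∀ p : ℕ+ → Bool, (T.filter p).length < n := fun p => by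
        rw [← hn, List.length_append]
        exact Nat.lt_succ_of_le (List.length_filter_le p T)
      replace hp := hp.trans (List.perm_append_singleton t T)
      rw [List.pairwise_append] at hT
      obtain ⟨l, r, rfl⟩ := List.append_of_mem (hp.mem_iff.2 (List.mem_cons_self (a := t) (l := T)))
      have hp' : (l ++ r).Perm T := (List.perm_middle.symm.trans hp).cons_inv
      have hTt : ∀ x ∈ T, x < t := fun x hx => hT.2.2 x hx t (List.mem_singleton_self t)
      have hlt : ∀ x ∈ l, x < t := fun x hx => hTt x (hp'.mem_iff.1 (List.mem_append_left r hx))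
      have hrt : ∀ x ∈ r, x < t := fun x hx => hTt x (hp'.mem_iff.1 (List.mem_append_right l hx))
      rw [List.pairwise_append, List.pairwise_cons] at hL
      obtain ⟨hl, ⟨hr1, hr⟩, hlr⟩ := hL
      have hlf : ∀ x ∈ l, f x ≤ f t := fun x hx => by
        rcases hlr x hx t List.mem_cons_self with h | h
        exacts [h.le, h.1.le]
      have hrf : ∀ x ∈ r, f t < f x := fun x hx => by
        rcases hr1 x hx with h | h
        exacts [h, absurd (hrt x hx) h.2.not_gt]
      obtain ⟨p1, p2⟩ := perm_filter_of_append_perm (fun x => decide (f x ≤ f t)) hp'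
        (fun x hx => by simpa using hlf x hx) (fun x hx => by simpa using hrf x hx)
      have e1 := ih _ (hlen _) _ l (hT.1.filter _) p1 hl rfl
      have e2 := ih _ (hlen _) _ r (hT.1.filter _) p2 hr rfl
      rw [decTree_append_cons hlt hrt, List.map_append, List.map_cons, List.map_nil,
        rightTree_append_singleton, List.filter_map, List.filter_map]
      simp only [decide_not, shape, BinaryTree.map, BinaryTree.node.injEq, true_and] at e1 e2 ⊢
      exact ⟨e1, e2⟩

/-! ### Descents and the canopy of the decreasing tree -/

/-- For each position of a word, whether the letter there is followed immediately by a smaller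
letter (`false` in the last position). -/
def descents : Word → List Bool
  | [] => []
  | [_] => [false]
  | a :: b :: w => decide (b < a) :: descents (b :: w)

/-- For each node of a binary tree, in infix order, whether it has a right child. -/
def canopy {α : Type*} : BinaryTree α → List Bool
  | .nil => []
  | .node _ l .nil => canopy l ++ [false]
  | .node _ l r@(.node _ _ _) => canopy l ++ true :: canopy r

theorem canopy_shape {α : Type*} (T : BinaryTree α) : canopy (shape T) = canopy T := by
  induction T with
  | nil => simp [shape, BinaryTree.map, canopy]
  | node a l r hl hr =>
    cases r with
    | nil => simp only [shape, BinaryTree.map, canopy] at hl ⊢; rw [hl]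
    | node b r1 r2 => simp only [shape, BinaryTree.map, canopy] at hl hr ⊢; rw [hl, hr]

theorem descents_getElem? (w : Word) (k : ℕ) (h : k + 1 < w.length) :
    (descents w)[k]? = some (decide (w[k + 1] < w[k])) := by
  induction w generalizing k with
  | nil => simp at h
  | cons a w ih =>
    cases w with
    | nil => simp at h
    | cons b w =>
      cases k with
      | zero => simp [descents]
      | succ k => 
        rw [descents, List.getElem?_cons_succ]
        exact ih k (by simpa using h)

theorem descents_append_singleton {l : Word} {m : ℕ+} (hl : ∀ x ∈ l, x < m) :
    descents (l ++ [m]) = descents l ++ [false] := by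
  induction l with
  | nil => rfl
  | cons a l ih =>
    cases l with
    | nil => simpa [descents] using (hl a (by simp)).le
    | cons b l =>
      have := ih fun x hx => hl x (List.mem_cons_of_mem a hx)
      simp only [List.cons_append, descents] at this ⊢
      rw [this]

theorem descents_append_cons_cons {l : Word} {m b : ℕ+} (r : Word) (hl : ∀ x ∈ l, x < m)
    (hb : b < m) :
    descents (l ++ m :: b :: r) = descents l ++ true :: descents (b :: r) := by
  induction l with
  | nil => simp [descents, hb]
  | cons a l ih =>
    cases l with
    | nil => simp [descents, hb, (hl a (by simp)).le]
    | cons c l =>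
      have := ih fun x hx => hl x (List.mem_cons_of_mem a hx)
      simp only [List.cons_append, descents] at this ⊢
      rw [this]

/-- Descents are visible in the shape of the decreasing tree: a letter is followed by a smaller one
exactly if its node has a right child. -/
theorem descents_eq_canopy (w : Word) (hw : w.Nodup) : descents w = canopy (decTree w) := by
  induction hn : w.length using Nat.strong_induction_on generalizing w with
  | _ n ih =>
    by_cases hne : w = []
    · subst hne; simp [decTree, descents, canopy]
    · obtain ⟨l, r, hlr⟩ := List.append_of_mem (List.max_mem hne)
      set m := w.max hne
      have hmax : ∀ x ∈ w, x ≤ m := fun x hx => List.le_max_of_mem hx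
      clear_value m
      subst hlr
      rw [List.nodup_append, List.nodup_cons] at hw
      obtain ⟨hl, ⟨hmr, hr⟩, hd⟩ := hw
      have hlm : ∀ x ∈ l, x < m := fun x hx =>
        lt_of_le_of_ne (hmax x (by simp [hx])) (hd x hx m (by simp))
      have hrm : ∀ x ∈ r, x < m := fun x hx =>
        lt_of_le_of_ne (hmax x (by simp [hx])) fun h => hmr (h ▸ hx)
      rw [List.length_append, List.length_cons] at hn
      rw [decTree_append_cons hlm hrm]
      have hl' := ih l.length (by omega) l hl rfl
      have hr' := ih r.length (by omega) r hr rfl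
      cases r with
      | nil => rw [descents_append_singleton hlm, hl', decTree.eq_def []]; simp [canopy]
      | cons b r =>
        rw [descents_append_cons_cons r hlm (hrm b (by simp)), hl', hr']
        conv_lhs => rw [decTree.eq_def (b :: r)]
        conv_rhs => rw [decTree.eq_def (b :: r)]
        simp [canopy]

/-! ### Standardization -/

/-- `Tuple.sort` is the stable sort, so it orders positions as in the definition of `std`. -/
theorem before_sort_iff {n : ℕ} {α : Type*} [LinearOrder α] (f : Fin n → α) (k l : Fin n) :
    (f (Tuple.sort f k) < f (Tuple.sort f l) ∨
      (f (Tuple.sort f k) = f (Tuple.sort f l) ∧ Tuple.sort f k < Tuple.sort f l)) ↔ k < l := by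
  obtain ⟨hm, hs⟩ := (Tuple.eq_sort_iff (f := f)).1 rfl
  constructor
  · intro h
    by_contra hkl
    rcases (not_lt.1 hkl).eq_or_lt with rfl | hlk
    · simp at h
    · have h1 : f (Tuple.sort f l) ≤ f (Tuple.sort f k) := hm hlk.le
      rcases h with h | h
      · exact h1.not_gt h
      · exact (hs l k hlk h.1.symm).not_gt h.2
  · intro hkl
    have h1 : f (Tuple.sort f k) ≤ f (Tuple.sort f l) := hm hkl.le
    exact h1.lt_or_eq.imp_right fun h => ⟨h, hs k l hkl h⟩

theorem std_eq_ofFn (u : Word) :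
    std u = List.ofFn fun p => Nat.succPNat ((Tuple.sort u.get).symm p) := by
  rw [std, List.ofFn_inj]
  funext p
  obtain ⟨k, rfl⟩ := (Tuple.sort u.get).surjective p
  have : Finset.univ.filter (fun q => Before u q (Tuple.sort u.get k)) =
      (Finset.Iio k).map (Tuple.sort u.get).toEmbedding := by
    ext q
    obtain ⟨l, rfl⟩ := (Tuple.sort u.get).surjective q
    rw [Finset.mem_filter, Finset.mem_map_equiv, Finset.mem_Iio, Equiv.symm_apply_apply]
    exact (and_iff_right (Finset.mem_univ _)).trans (before_sort_iff u.get l k)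
  rw [this, Finset.card_map, Fin.card_Iio, Equiv.symm_apply_apply]

theorem inverse_std_ofFn {n : ℕ} (f : Fin n → ℕ+) :
    inverse (std (List.ofFn f)) = List.ofFn fun k => Nat.succPNat (Tuple.sort f k) := by
  generalize hu : List.ofFn f = u
  obtain rfl : n = u.length := by rw [← hu, List.length_ofFn]
  obtain rfl : f = u.get := List.ofFn_injective (hu.trans (List.ofFn_get u).symm)
  have hlen : (std u).length = u.length := by rw [std, List.length_ofFn]
  refine List.ext_getElem (by simp [inverse, hlen]) fun j h1 h2 => ?_
  rw [List.length_ofFn] at h2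
  simp only [inverse, List.getElem_ofFn]
  congr 1
  have hnd : (std u).Nodup := by
    rw [std_eq_ofFn, List.nodup_ofFn]
    exact Nat.succPNat_injective.comp (Fin.val_injective.comp (Equiv.injective _))
  have hlt : (Tuple.sort u.get ⟨j, h2⟩ : ℕ) < (std u).length := by rw [hlen]; exact Fin.isLt _
  have : (std u)[(Tuple.sort u.get ⟨j, h2⟩ : ℕ)] = Nat.succPNat j := by
    simp [std_eq_ofFn]
  rw [← this, hnd.idxOf_getElem]

/-- The shape of a word depends on its standardization only. -/
theorem baxtShape_ofFn_congr {n : ℕ} {f g : Fin n → ℕ+} (h : Tuple.sort f = Tuple.sort g) :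
    baxtShape (List.ofFn f) = baxtShape (List.ofFn g) := by
  rw [baxtShape, baxtShape, inverse_std_ofFn, inverse_std_ofFn, h]

/-- The shapes of the trees of `std(u)⁻¹` are those of the search trees of `u`. -/
theorem baxtShape_eq (u : Word) : baxtShape u = (shape (leftTree u), shape (rightTree u)) := by
  obtain ⟨n, f, rfl⟩ : ∃ n, ∃ f : Fin n → ℕ+, u = List.ofFn f := ⟨_, _, (List.ofFn_get u).symm⟩
  let F : ℕ+ → ℕ+ := fun t => if h : t.natPred < n then f ⟨t.natPred, h⟩ else 1
  have hF : ∀ p : Fin n, F (Nat.succPNat p) = f p := fun p => by simp [F]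
  have hmap : (List.ofFn fun p : Fin n => Nat.succPNat p).map F = List.ofFn f := by
    rw [List.map_ofFn]
    exact congrArg List.ofFn (funext hF)
  have hT : (List.ofFn fun p : Fin n => Nat.succPNat p).Pairwise (· < ·) := by
    rw [List.pairwise_ofFn]
    exact fun i j hij => Nat.succPNat_lt_succPNat.2 hij
  have hp : (List.ofFn fun k => Nat.succPNat (Tuple.sort f k)).Perm
      (List.ofFn fun p : Fin n => Nat.succPNat p) :=
    (Tuple.sort f).ofFn_comp_perm fun p : Fin n => Nat.succPNat p
  have hL : (List.ofFn fun k => Nat.succPNat (Tuple.sort f k)).Pairwise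
      fun p q => F p < F q ∨ (F p = F q ∧ p < q) := by
    rw [List.pairwise_ofFn]
    intro i j hij
    rw [hF, hF, Nat.succPNat_lt_succPNat]
    exact (before_sort_iff f i j).2 hij
  rw [baxtShape, inverse_std_ofFn, shape_incTree_eq F _ _ hT hp hL,
    shape_decTree_eq F _ _ hT hp hL, hmap]

/-- The shape of a word determines the descents of its inverse standardization. -/
theorem sort_lt_iff_of_baxtShape_eq {n : ℕ} {f g : Fin n → ℕ+}
    (h : baxtShape (List.ofFn f) = baxtShape (List.ofFn g)) {k l : Fin n}
    (hkl : l.val = k.val + 1) :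
    Tuple.sort f l < Tuple.sort f k ↔ Tuple.sort g l < Tuple.sort g k := by
  have key : ∀ f : Fin n → ℕ+, (canopy (baxtShape (List.ofFn f)).2)[k.val]? =
      some (decide (Tuple.sort f l < Tuple.sort f k)) := fun f => by
    have hnd : (List.ofFn fun k => Nat.succPNat (Tuple.sort f k)).Nodup := by
      rw [List.nodup_ofFn]
      exact Nat.succPNat_injective.comp (Fin.val_injective.comp (Equiv.injective _))
    have hk : k.val + 1 < n := hkl ▸ l.isLt
    rw [baxtShape, inverse_std_ofFn, canopy_shape, ← descents_eq_canopy _ hnd,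
      descents_getElem? _ _ (by simpa using hk)]
    simp [← hkl]
  have := key f
  rw [h, key g] at this
  simpa using this.symm

/-! ### Edges of the quasi-crystal graph -/

theorem not_pair_sublist_iff (a b : ℕ+) (x : Word) :
    ¬ [a, b].Sublist x ↔ x.Pairwise fun c d => ¬ (c = a ∧ d = b) := by
  rw [List.pairwise_iff_forall_sublist]
  constructor
  · rintro h c d hs ⟨rfl, rfl⟩
    exact h hs
  · exact fun h hs => h hs ⟨rfl, rfl⟩

theorem edge_iff {i : ℕ+} {x y : Word} :
    Edge i x y ↔ ∃ l r, x = l ++ i :: r ∧ i ∉ r ∧ i + 1 ∉ l ∧ y = l ++ (i + 1) :: r := by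
  have hii : i ≠ i + 1 := (PNat.lt_add_right i 1).ne
  have hset : ∀ l r : Word, i ∉ r →
      ((l ++ i :: r).reverse.set ((l ++ i :: r).reverse.idxOf i) (i + 1)).reverse =
        l ++ (i + 1) :: r := fun l r hr => by
    have : (l ++ i :: r).reverse.idxOf i = r.reverse.length := by
      rw [List.reverse_append, List.reverse_cons, List.append_assoc,
        List.idxOf_append_of_notMem (by simpa using hr)]
      simp
    rw [this]
    simp
  unfold Edge lower
  constructor
  · intro h
    split_ifs at h with h1 h2
    obtain ⟨r, l, hx, hr⟩ := List.eq_append_cons_of_mem (List.mem_reverse.2 h2)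
    obtain rfl : x = l.reverse ++ i :: r.reverse := by
      rw [← List.reverse_reverse x, hx]; simp
    rw [not_pair_sublist_iff, List.pairwise_append] at h1
    rw [hset _ _ (by simpa using hr), Option.some.injEq] at h
    exact ⟨_, _, rfl, by simpa using hr,
      fun hl => h1.2.2 _ hl i List.mem_cons_self ⟨rfl, rfl⟩, h.symm⟩
  · rintro ⟨l, r, rfl, hr, hl, rfl⟩
    have h1 : ¬ [i + 1, i].Sublist (l ++ i :: r) := by
      rw [not_pair_sublist_iff, List.pairwise_append, List.pairwise_cons]
      refine ⟨?_, ⟨fun a _ h => hii h.1, ?_⟩, fun a ha b _ h => hl (h.1 ▸ ha)⟩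
      · exact List.pairwise_of_forall_mem_list fun a ha b _ h => hl (h.1 ▸ ha)
      · exact List.pairwise_of_forall_mem_list fun a _ b hb h => hr (h.2 ▸ hb)
    rw [if_neg h1, if_pos (by simp), hset l r hr]

theorem Edge.length_eq {i : ℕ+} {x y : Word} (h : Edge i x y) : x.length = y.length := by
  obtain ⟨l, r, rfl, -, -, rfl⟩ := edge_iff.1 h
  simp

theorem ofFn_update {n : ℕ} (f : Fin n → ℕ+) (p : Fin n) (a : ℕ+) :
    List.ofFn (Function.update f p a) =
      (List.ofFn f).take p ++ a :: (List.ofFn f).drop (p + 1) := by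
  have : List.ofFn (Function.update f p a) = (List.ofFn f).set p a := by
    refine List.ext_getElem (by simp) fun j h1 h2 => ?_
    simp [List.getElem_set, Function.update_apply, Fin.ext_iff, eq_comm]
  rw [this, List.set_eq_take_append_cons_drop, if_pos (by simp)]

theorem edge_ofFn_iff {n : ℕ} {i : ℕ+} {f : Fin n → ℕ+} {y : Word} :
    Edge i (List.ofFn f) y ↔ ∃ p, f p = i ∧ (∀ q, p < q → f q ≠ i) ∧ (∀ q, q < p → f q ≠ i + 1) ∧
      y = List.ofFn (Function.update f p (i + 1)) := by
  rw [edge_iff]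
  constructor
  · rintro ⟨l, r, hx, hr, hl, rfl⟩
    have hn : n = l.length + (r.length + 1) := by simpa using congrArg List.length hx
    have hf : ∀ (q : Fin n), (l ++ i :: r)[q.val]? = some (f q) := fun q => by
      rw [← hx]; simp
    refine ⟨⟨l.length, by omega⟩, ?_, fun q hq hqi => hr ?_, fun q hq hqi => hl ?_, ?_⟩
    · simpa using (hf ⟨l.length, by omega⟩).symm
    · have := hf q
      rw [Fin.lt_def] at hq
      rw [List.getElem?_append_right hq.le, hqi] at this
      obtain ⟨m, hm⟩ := Nat.exists_eq_add_of_lt hq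
      rw [hm, show l.length + m + 1 - l.length = m + 1 by omega, List.getElem?_cons_succ] at this
      exact List.mem_of_getElem? this
    · have := hf q
      rw [Fin.lt_def] at hq
      rw [List.getElem?_append_left hq, hqi] at this
      exact List.mem_of_getElem? this
    · rw [ofFn_update, hx]
      simp
  · rintro ⟨p, hp, h1, h2, rfl⟩
    refine ⟨(List.ofFn f).take p, (List.ofFn f).drop (p + 1), ?_, fun h => ?_, fun h => ?_,
      ofFn_update f p (i + 1)⟩
    · rw [← ofFn_update, ← hp, Function.update_eq_self]
    · obtain ⟨m, hm, he⟩ := List.mem_iff_getElem.1 h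
      rw [List.length_drop, List.length_ofFn] at hm
      rw [List.getElem_drop, List.getElem_ofFn] at he
      exact h1 _ (Fin.lt_def.2 (by simp; omega)) he
    · obtain ⟨m, hm, he⟩ := List.mem_iff_getElem.1 h
      rw [List.length_take, List.length_ofFn] at hm
      rw [List.getElem_take, List.getElem_ofFn] at he
      exact h2 _ (Fin.lt_def.2 (by simp; omega)) he

/-- The operator `f_i` increments the last letter `i` of the sorted word, and it is defined exactly
if this does not change the standardization. -/
theorem edge_ofFn_iff_sort {n : ℕ} {i : ℕ+} {f : Fin n → ℕ+} {y : Word} :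
    Edge i (List.ofFn f) y ↔ ∃ p, f p = i ∧
      Tuple.sort (Function.update f p (i + 1)) = Tuple.sort f ∧
      y = List.ofFn (Function.update f p (i + 1)) := by
  rw [edge_ofFn_iff]
  refine exists_congr fun p => and_congr_right fun hp => ?_
  rw [← and_assoc]
  refine and_congr_left fun _ => ?_
  have hii : i < i + 1 := PNat.lt_add_right i 1
  have hb := before_sort_iff f
  have hne : ∀ {k l : Fin n}, k ≠ l → Tuple.sort f k ≠ Tuple.sort f l :=
    fun h => (Tuple.sort f).injective.ne h
  obtain ⟨k, rfl⟩ := (Tuple.sort f).surjective p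
  constructor
  · rintro ⟨h1, h2⟩
    symm
    rw [Tuple.eq_sort_iff]
    have hlt : ∀ a b, a < b →
        Function.update f (Tuple.sort f k) (i + 1) (Tuple.sort f a) <
          Function.update f (Tuple.sort f k) (i + 1) (Tuple.sort f b) ∨
        (Function.update f (Tuple.sort f k) (i + 1) (Tuple.sort f a) =
          Function.update f (Tuple.sort f k) (i + 1) (Tuple.sort f b) ∧
          Tuple.sort f a < Tuple.sort f b) := by
      intro a b hab
      have hfab := (hb a b).2 hab
      by_cases hak : a = k
      · subst hak
        rw [Function.update_self, Function.update_of_ne (hne hab.ne')]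
        rw [hp] at hfab
        have : i < f (Tuple.sort f b) := hfab.resolve_right fun h => h1 _ h.2 h.1.symm
        refine (PNat.add_one_le_iff.2 this).lt_or_eq.imp_right fun h => ⟨h, ?_⟩
        exact lt_of_not_ge fun hle => h2 _ (lt_of_le_of_ne hle (hne hab.ne')) h.symm
      · rw [Function.update_of_ne (hne hak)]
        by_cases hbk : b = k
        · subst hbk
          rw [Function.update_self]
          rw [hp] at hfab
          exact .inl ((hfab.elim le_of_lt fun h => h.1.le).trans_lt hii)
        · rwa [Function.update_of_ne (hne hbk)]
    refine ⟨fun a b hab => ?_, fun a b hab he => ((hlt a b hab).resolve_left he.not_lt).2⟩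
    rcases hab.eq_or_lt with rfl | hab
    · rfl
    · exact (hlt a b hab).elim le_of_lt fun h => h.1.le
  · intro hs
    have hb' := before_sort_iff (Function.update f (Tuple.sort f k) (i + 1))
    rw [hs] at hb'
    constructor
    · intro q hq hqi
      obtain ⟨l, rfl⟩ := (Tuple.sort f).surjective q
      have hkl : k < l := (hb k l).1 (.inr ⟨hp.trans hqi.symm, hq⟩)
      have := (hb' k l).2 hkl
      rw [Function.update_self, Function.update_of_ne (hne hkl.ne'), hqi] at this
      exact this.elim hii.not_gt fun h => hii.ne' h.1
    · intro q hq hqi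
      obtain ⟨l, rfl⟩ := (Tuple.sort f).surjective q
      have hkl : k < l := (hb k l).1 (.inl (by rw [hp, hqi]; exact hii))
      have := (hb' k l).2 hkl
      rw [Function.update_self, Function.update_of_ne (hne hkl.ne'), hqi] at this
      exact this.elim (lt_irrefl _) fun h => h.2.not_gt hq

/-! ### Quasi-crystal isomorphisms from bisimulations -/

/-- A relation `R` between words is a simulation of the quasi-crystal graph if every edge at a word
`x`, in either direction, is matched by an edge with the same label at every word related
to `x`. It is also required to be functional: a word is related to at most one word. -/
structure IsSimulation (R : Word → Word → Prop) : Prop where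
  out : ∀ {i x y x'}, R x y → Edge i x x' → ∃ y', Edge i y y' ∧ R x' y'
  into : ∀ {i x y x'}, R x y → Edge i x' x → ∃ y', Edge i y' y ∧ R x' y'
  unique : ∀ {x y y'}, R x y → R x y' → y = y'

theorem IsSimulation.exists_mem_component {R : Word → Word → Prop} (hR : IsSimulation R)
    {u v : Word} (huv : R u v) {x : Word} (hx : x ∈ component u) : ∃ y ∈ component v, R x y := by
  have key : ∀ a b, Relation.EqvGen (fun y z => ∃ i : ℕ+, Edge i y z) a b →
      ((∃ y ∈ component v, R a y) ↔ ∃ y ∈ component v, R b y) := by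
    intro a b hab
    induction hab with
    | rel a b h =>
      obtain ⟨i, h⟩ := h
      constructor
      · rintro ⟨y, hy, hr⟩
        obtain ⟨y', he, hr'⟩ := hR.out hr h
        exact ⟨y', hy.trans _ _ _ (.rel _ _ ⟨i, he⟩), hr'⟩
      · rintro ⟨y, hy, hr⟩
        obtain ⟨y', he, hr'⟩ := hR.into hr h
        exact ⟨y', hy.trans _ _ _ (.symm _ _ (.rel _ _ ⟨i, he⟩)), hr'⟩
    | refl a => rfl
    | symm a b _ ih => exact ih.symm
    | trans a b c _ _ ih1 ih2 => exact ih1.trans ih2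
  exact (key u x hx).1 ⟨v, mem_component_self v, huv⟩

theorem exists_quasiCrystalIso {R : Word → Word → Prop} (hR : IsSimulation R)
    (hR' : IsSimulation (flip R)) {u v : Word} (huv : R u v) :
    ∃ θ : QuasiCrystalIso u v, ∀ w : component u, R w (θ.toEquiv w) := by
  choose F hF hRF using fun x : component u => hR.exists_mem_component huv x.2
  choose G hG hRG using fun y : component v => hR'.exists_mem_component (u := v) (v := u) huv y.2
  refine ⟨⟨⟨fun x => ⟨F x, hF x⟩, fun y => ⟨G y, hG y⟩, fun x => ?_, fun y => ?_⟩, ?_⟩, hRF⟩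
  · exact Subtype.ext (hR'.unique (hRG ⟨F x, hF x⟩) (hRF x))
  · exact Subtype.ext (hR.unique (hRF ⟨G y, hG y⟩) (hRG y))
  · intro i x y
    change Edge i (F x) (F y) ↔ _
    constructor
    · intro h
      obtain ⟨z, hz, hr⟩ := hR'.out (hRF x) h
      rwa [hR'.unique (hRF y) hr]
    · intro h
      obtain ⟨z, hz, hr⟩ := hR.out (hRF x) h
      rwa [hR.unique (hRF y) hr]

/-- The words `x` and `y` have the same content, and their letters in increasing order, with equal
letters from left to right, are in the positions `s 0, s 1, …` of `x` and `t 0, t 1, …` of `y`. -/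
def Matched {n : ℕ} (s t : Equiv.Perm (Fin n)) (x y : Word) : Prop :=
  ∃ f g : Fin n → ℕ+, x = List.ofFn f ∧ y = List.ofFn g ∧ Tuple.sort f = s ∧ Tuple.sort g = t ∧
    f ∘ s = g ∘ t

theorem flip_matched {n : ℕ} (s t : Equiv.Perm (Fin n)) : flip (Matched s t) = Matched t s := by
  funext y x
  refine propext ⟨?_, ?_⟩
  · rintro ⟨f, g, hx, hy, hs, ht, h⟩
    exact ⟨g, f, hy, hx, ht, hs, h.symm⟩
  · rintro ⟨g, f, hy, hx, ht, hs, h⟩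
    exact ⟨f, g, hx, hy, hs, ht, h.symm⟩

/-- Whether a weakly increasing content is compatible with an inverse standardization depends only
on the descents of the latter: the content must increase at each of them. -/
theorem sort_eq_of_comp_eq {n : ℕ} {s t : Equiv.Perm (Fin n)}
    (hst : ∀ k l : Fin n, l.val = k.val + 1 → (s l < s k ↔ t l < t k))
    {f g : Fin n → ℕ+} (hf : Tuple.sort f = s) (h : f ∘ s = g ∘ t) : Tuple.sort g = t := by
  obtain ⟨hm, hs⟩ := Tuple.eq_sort_iff.1 hf.symm
  symm
  rw [Tuple.eq_sort_iff]
  refine ⟨h ▸ hm, ?_⟩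
  have hst' : ∀ k l : Fin n, l.val = k.val + 1 → f (s k) = f (s l) → t k < t l := by
    intro k l hkl he
    have hlt : k < l := by rw [Fin.lt_def]; omega
    have h1 := hs k l hlt he
    exact lt_of_le_of_ne (not_lt.1 fun h2 => h1.not_gt ((hst k l hkl).2 h2))
      (t.injective.ne hlt.ne)
  have key : ∀ (d : ℕ) (i j : Fin n), j.val = i.val + d + 1 → f (s i) = f (s j) → t i < t j := by
    intro d
    induction d with
    | zero => exact fun i j hij => hst' i j hij
    | succ d ih =>
      intro i j hij he
      let k : Fin n := ⟨i.val + d + 1, by have := j.isLt; omega⟩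
      have hik : f (s i) ≤ f (s k) := hm (Fin.le_def.2 (by simp only [k]; omega))
      have hkj : f (s k) ≤ f (s j) := hm (Fin.le_def.2 (by simp only [k]; omega))
      have hkj' : f (s k) = f (s j) := le_antisymm hkj (he ▸ hik)
      exact (ih i k rfl (he.trans hkj'.symm)).trans (hst' k j (by simp only [k]; omega) hkj')
  intro i j hij he
  obtain ⟨d, hd⟩ := Nat.exists_eq_add_of_lt (Fin.lt_def.1 hij)
  have hfg : ∀ a, f (s a) = g (t a) := congrFun h
  exact key d i j hd (by rw [hfg, hfg, he])

theorem isSimulation_matched {n : ℕ} {s t : Equiv.Perm (Fin n)}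
    (hst : ∀ k l : Fin n, l.val = k.val + 1 → (s l < s k ↔ t l < t k)) :
    IsSimulation (Matched s t) where
  out := by
    rintro i x y x' ⟨f, g, rfl, rfl, hf, hg, h⟩ he
    obtain ⟨p, hp, hs, rfl⟩ := edge_ofFn_iff_sort.1 he
    obtain ⟨k, rfl⟩ := s.surjective p
    have h' : Function.update f (s k) (i + 1) ∘ s = Function.update g (t k) (i + 1) ∘ t := by
      rw [Function.update_comp_eq_of_injective _ s.injective,
        Function.update_comp_eq_of_injective _ t.injective, h]
    have ht := sort_eq_of_comp_eq hst (hs.trans hf) h'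
    exact ⟨_, edge_ofFn_iff_sort.2 ⟨t k, (congrFun h k).symm.trans hp, ht.trans hg.symm, rfl⟩,
      _, _, rfl, rfl, hs.trans hf, ht, h'⟩
  into := by
    rintro i x y x' ⟨f, g, rfl, rfl, hf, hg, h⟩ he
    obtain ⟨f', rfl⟩ : ∃ f' : Fin n → ℕ+, x' = List.ofFn f' := by
      obtain rfl : x'.length = n := by simpa using he.length_eq
      exact ⟨_, (List.ofFn_get x').symm⟩
    obtain ⟨p, hp, hs, hff'⟩ := edge_ofFn_iff_sort.1 he
    obtain rfl := List.ofFn_injective hff'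
    obtain ⟨k, rfl⟩ := s.surjective p
    have hs' := hs.symm.trans hf
    have h0 : f' ∘ s = (f' ∘ s ∘ t.symm) ∘ t := by funext a; simp
    have ht' := sort_eq_of_comp_eq hst hs' h0
    have hgu : g = Function.update (f' ∘ s ∘ t.symm) (t k) (i + 1) := by
      refine t.surjective.injective_comp_right ?_
      change g ∘ t = _ ∘ t
      rw [← h, Function.update_comp_eq_of_injective _ s.injective,
        Function.update_comp_eq_of_injective _ t.injective, ← h0]
    refine ⟨List.ofFn (f' ∘ s ∘ t.symm), edge_ofFn_iff_sort.2 ⟨t k, by simpa using hp, ?_, ?_⟩,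
      f', _, rfl, rfl, hs', ht', h0⟩
    · rw [← hgu, hg, ht']
    · rw [← hgu]
  unique := by
    rintro x y y' ⟨f, g, rfl, rfl, -, -, h⟩ ⟨f', g', hff', rfl, -, -, h'⟩
    obtain rfl := List.ofFn_injective hff'
    rw [h] at h'
    rw [t.surjective.injective_comp_right h']

/-- Words with the same content and the same shape are matched by the sorting permutations of their
positions, which have the same descents. -/
theorem simBaxt_of_perm {u v : Word} (hp : u.Perm v) (h : baxtShape u = baxtShape v) :
    SimBaxt u v := by
  obtain ⟨n, f, rfl⟩ : ∃ n, ∃ f : Fin n → ℕ+, u = List.ofFn f := ⟨_, _, (List.ofFn_get u).symm⟩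
  obtain ⟨g, rfl⟩ : ∃ g : Fin n → ℕ+, v = List.ofFn g := by
    obtain rfl : v.length = n := by simpa using hp.length_eq.symm
    exact ⟨_, (List.ofFn_get v).symm⟩
  have hst : ∀ k l : Fin n, l.val = k.val + 1 →
      (Tuple.sort f l < Tuple.sort f k ↔ Tuple.sort g l < Tuple.sort g k) :=
    fun k l hkl => sort_lt_iff_of_baxtShape_eq h hkl
  have hfg : f ∘ Tuple.sort f = g ∘ Tuple.sort g := List.ofFn_injective <|
    ((((Tuple.sort f).ofFn_comp_perm f).trans hp).trans
      ((Tuple.sort g).ofFn_comp_perm g).symm).eq_of_pairwise'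
      (Tuple.monotone_sort f).sortedLE_ofFn.pairwise (Tuple.monotone_sort g).sortedLE_ofFn.pairwise
  have huv : Matched (Tuple.sort f) (Tuple.sort g) (List.ofFn f) (List.ofFn g) :=
    ⟨f, g, rfl, rfl, rfl, rfl, hfg⟩
  have hR := isSimulation_matched hst
  obtain ⟨θ, hθ⟩ := exists_quasiCrystalIso hR
    (flip_matched _ _ ▸ isSimulation_matched fun k l hkl => (hst k l hkl).symm) huv
  refine ⟨θ, fun w => ?_, hR.unique (hθ ⟨_, mem_component_self _⟩) huv⟩
  obtain ⟨f', g', hw, hw', hf, hg, -⟩ := hθ w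
  rw [hw, hw', baxtShape_ofFn_congr hf, baxtShape_ofFn_congr hg, h]

/-! ### Quasi-crystal isomorphisms preserve content -/

/-- `y` is obtained from `x` by operators `f_k` with `j ≤ k`. -/
abbrev RaisesFrom (j : ℕ+) : Word → Word → Prop :=
  Relation.ReflTransGen fun x y => ∃ k, j ≤ k ∧ Edge k x y

theorem Edge.count_eq {k i : ℕ+} {x y : Word} (h : Edge k x y) (hi : i < k) :
    y.count i = x.count i := by
  obtain ⟨l, r, rfl, -, -, rfl⟩ := edge_iff.1 h
  have : k ≠ i := hi.ne'
  have : k + 1 ≠ i := (hi.trans (PNat.lt_add_right k 1)).ne'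
  simp [*]

theorem RaisesFrom.count_eq {j i : ℕ+} {x y : Word} (h : RaisesFrom j x y) (hi : i < j) :
    y.count i = x.count i := by
  induction h with
  | refl => rfl
  | tail _ h ih =>
    obtain ⟨k, hk, h⟩ := h
    rw [h.count_eq (hi.trans_le hk), ih]

theorem Edge.count_self {i : ℕ+} {x y : Word} (h : Edge i x y) :
    x.count i = y.count i + 1 := by
  obtain ⟨l, r, rfl, -, -, rfl⟩ := edge_iff.1 h
  have : i + 1 ≠ i := (PNat.lt_add_right i 1).ne'
  simp [this]
  omega

/-- That no `i + 1` stands to the left of an `i` is phrased through a splitting `l ++ r` of the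
word, with no `i + 1` in `l` and no `i` in `r`. Applying `f_i` preserves this, so that it can be
repeated until no `i` is left. -/
theorem exists_edge {i : ℕ+} {l r : Word} (hl : i + 1 ∉ l) (hr : i ∉ r) (hi : i ∈ l) :
    ∃ l' r', Edge i (l ++ r) (l' ++ r') ∧ i + 1 ∉ l' ∧ i ∉ r' := by
  obtain ⟨b, a, hab, hb⟩ := List.eq_append_cons_of_mem (List.mem_reverse.2 hi)
  obtain rfl : l = a.reverse ++ i :: b.reverse := by
    rw [← List.reverse_reverse l, hab]; simp
  have hii : i ≠ i + 1 := (PNat.lt_add_right i 1).ne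
  refine ⟨a.reverse, (i + 1) :: (b.reverse ++ r), edge_iff.2
    ⟨a.reverse, b.reverse ++ r, by simp, by simp [hb, hr], fun h => hl (by simp_all), rfl⟩,
    fun h => hl (by simp_all), by simp [hb, hr, hii]⟩

theorem exists_raisesFrom_notMem_of_append {i : ℕ+} (n : ℕ) (l r : Word) (hn : (l ++ r).count i = n)
    (hl : i + 1 ∉ l) (hr : i ∉ r) : ∃ y, RaisesFrom i (l ++ r) y ∧ i ∉ y := by
  induction n generalizing l r with
  | zero => exact ⟨l ++ r, .refl, List.count_eq_zero.1 hn⟩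
  | succ n ih =>
    have hi : i ∈ l := by
      have : i ∈ l ++ r := List.count_pos_iff.1 (by omega)
      exact (List.mem_append.1 this).resolve_right hr
    obtain ⟨l', r', he, hl', hr'⟩ := exists_edge hl hr hi
    obtain ⟨y, hy, hiy⟩ := ih l' r' (by have := he.count_self; omega) hl' hr'
    exact ⟨y, .head ⟨i, le_rfl, he⟩ hy, hiy⟩

/-- Raising the larger letters out of the way, starting with the largest ones, removes all letters
`j` from a word without changing the smaller letters. -/
theorem exists_raisesFrom_notMem (d : ℕ) (j : ℕ+) (x : Word) (hx : ∀ a ∈ x, (a : ℕ) < j + d) :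
    ∃ y, RaisesFrom j x y ∧ j ∉ y := by
  induction d generalizing j x with
  | zero => exact ⟨x, .refl, fun h => (hx j h).false⟩
  | succ d ih =>
    obtain ⟨z, hz, hjz⟩ := ih (j + 1) x fun a ha => by
      have := hx a ha
      rw [PNat.add_coe, PNat.one_coe]
      omega
    obtain ⟨y, hy, hjy⟩ := exists_raisesFrom_notMem_of_append (i := j) _ z [] rfl hjz
      List.not_mem_nil
    rw [List.append_nil] at hy
    refine ⟨y, .trans (Relation.ReflTransGen.mono ?_ _ _ hz) hy, hjy⟩
    rintro a b ⟨k, hk, h⟩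
    exact ⟨k, (PNat.lt_add_right j 1).le.trans hk, h⟩

theorem exists_raisesFrom_of_simulation {S : Word → Word → Prop}
    (hS : ∀ {i x y x'}, S x y → Edge i x x' → ∃ y', Edge i y y' ∧ S x' y')
    {j : ℕ+} {x y x' : Word} (hxy : S x y) (h : RaisesFrom j x x') :
    ∃ y', RaisesFrom j y y' ∧ S x' y' := by
  induction h with
  | refl => exact ⟨y, .refl, hxy⟩
  | tail _ h ih =>
    obtain ⟨y', hy', hS'⟩ := ih
    obtain ⟨k, hk, h⟩ := h
    obtain ⟨z, hz, hS''⟩ := hS hS' h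
    exact ⟨z, .tail hy' ⟨k, hk, hz⟩, hS''⟩

theorem count_le_of_simulation_of_append {S : Word → Word → Prop}
    (hS : ∀ {i x y x'}, S x y → Edge i x x' → ∃ y', Edge i y y' ∧ S x' y')
    {i : ℕ+} (n : ℕ) (l r y : Word) (hn : (l ++ r).count i = n) (hl : i + 1 ∉ l) (hr : i ∉ r)
    (h : S (l ++ r) y) : n ≤ y.count i := by
  induction n generalizing l r y with
  | zero => exact Nat.zero_le _
  | succ n ih =>
    have hi : i ∈ l := by
      have : i ∈ l ++ r := List.count_pos_iff.1 (by omega)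
      exact (List.mem_append.1 this).resolve_right hr
    obtain ⟨l', r', he, hl', hr'⟩ := exists_edge hl hr hi
    obtain ⟨y', he', hS'⟩ := hS h he
    have := ih l' r' y' (by have := he.count_self; omega) hl' hr' hS'
    rw [he'.count_self]
    omega

/-- The number of letters `i` of `x` is the number of times `f_i` can be applied once the letters
`i + 1` are out of the way, and a word simulating `x` admits as many applications of `f_i`. -/
theorem count_le_of_simulation {S : Word → Word → Prop}
    (hS : ∀ {i x y x'}, S x y → Edge i x x' → ∃ y', Edge i y y' ∧ S x' y')
    {x y : Word} (h : S x y) (i : ℕ+) : x.count i ≤ y.count i := by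
  have hii : i < i + 1 := PNat.lt_add_right i 1
  obtain ⟨d, hd⟩ : ∃ d : ℕ, ∀ a ∈ x, (a : ℕ) < d :=
    ⟨(x.map PNat.val).sum + 1, fun a ha =>
      Nat.lt_succ_of_le (List.single_le_sum (by simp) _ (List.mem_map_of_mem ha))⟩
  obtain ⟨x', hx', hi⟩ := exists_raisesFrom_notMem d (i + 1) x fun a ha =>
    (hd a ha).trans_le (Nat.le_add_left _ _)
  obtain ⟨y', hy', hS'⟩ := exists_raisesFrom_of_simulation hS h hx'
  rw [← hx'.count_eq hii, ← hy'.count_eq hii]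
  rw [← List.append_nil x'] at hS' ⊢
  exact count_le_of_simulation_of_append hS _ x' [] y' rfl hi List.not_mem_nil hS'

theorem QuasiCrystalIso.perm {u v : Word} (θ : QuasiCrystalIso u v)
    (h : (θ.toEquiv ⟨u, mem_component_self u⟩ : Word) = v) : u.Perm v := by
  have hS : ∃ w : component u, (w : Word) = u ∧ (θ.toEquiv w : Word) = v := ⟨_, rfl, h⟩
  rw [List.perm_iff_count]
  refine fun i => le_antisymm
    (count_le_of_simulation (S := fun x y => ∃ w : component u, (w : Word) = x ∧
      (θ.toEquiv w : Word) = y) ?_ hS i)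
    (count_le_of_simulation (S := fun y x => ∃ w : component u, (w : Word) = x ∧
      (θ.toEquiv w : Word) = y) ?_ hS i)
  · rintro i _ _ x' ⟨w, rfl, rfl⟩ he
    let w' : component u := ⟨x', w.2.trans _ _ _ (.rel _ _ ⟨i, he⟩)⟩
    exact ⟨_, (θ.edge_iff i w w').2 he, w', rfl, rfl⟩
  · rintro i _ _ y' ⟨w, rfl, rfl⟩ he
    let z : component v := ⟨y', (θ.toEquiv w).2.trans _ _ _ (.rel _ _ ⟨i, he⟩)⟩
    refine ⟨_, (θ.edge_iff i w (θ.toEquiv.symm z)).1 ?_, θ.toEquiv.symm z, rfl, ?_⟩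
    · rwa [θ.toEquiv.apply_symm_apply]
    · rw [θ.toEquiv.apply_symm_apply]

end Baxt

theorem mainTheorem2 (u v : Baxt.Word) : Baxt.SimBaxt u v ↔ Baxt.BaxtEquiv u v := by
  rw [Baxt.baxtEquiv_iff, ← Prod.mk.injEq, ← Baxt.baxtShape_eq, ← Baxt.baxtShape_eq]
  constructor
  · rintro ⟨θ, hσ, hθ⟩
    have := hσ ⟨u, Baxt.mem_component_self u⟩
    rw [hθ] at this
    exact ⟨θ.perm hθ, this⟩
  · exact fun h => Baxt.simBaxt_of_perm h.1 h.2
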